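/- For an integer $r\ge 2$, an $r$-graph on $n$ vertices is a set of $r$-element subsets (edges) of an $n$-element vertex set; its density is its number of edges divided by $\binom nr$. A Hamiltonian cycle of an $r$-graph $G$ is the set of the $n$ sets $\{v_i,v_{i+1},\dots,v_{i+r-1}\}$ ($i=1,\dots,n$, indices modulo $n$) of an ordering $v_1,\dots,v_n$ of the vertices, where all these sets are edges of $G$; let $H(G)$ be the number of Hamiltonian cycles of $G$ (orderings giving the same set of edges are counted once). For $\varepsilon>0$ and $p\in(0,1)$, an $n$-vertex $r$-graph $G$ is $(\varepsilon,p)$-quasi-random if its density is exactly $p$ and, for every set $W$ of $\lfloor n/2\rfloor$ vertices, the density of the induced $r$-graph $G[W]$ lies in $(p-\varepsilon,p+\varepsilon)$. Let $H_r(n,p,\varepsilon)$ be the maximum of $H(G)$ over all $(\varepsilon,p)$-quasi-random $n$-vertex $r$-graphs $G$ (and $0$ if there are none), and let $E(n,p)=p^n(n-1)!/2$. **Theorem.** There is an absolute constant $c>0$ such that the following holds. Let $\varepsilon>0$ and let $p\in(0,1)$ be such that $1/p$ is an integer. Then there is $n_0=n_0(p,\varepsilon)$ such that for every $n\ge n_0$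 of the form $n=q^4+1$, where $q$ is a prime power and $p\,q^3(q^6+q^4+q^2+1)$ is an integer, $$ \frac{H_3(n,p,\varepsilon)}{E(n,p)}\;\ge\;(1/p)^{c\,n^{1/4}} . $$ -/

import Mathlib

namespace HyperHam

/-- An `r`-graph (`r`-uniform hypergraph) with vertex set `V`: a set of `r`-element subsets of `V`. -/
structure RGraph (r : ℕ) (V : Type*) where
  /-- The edge set. -/
  edges : Finset (Finset V)
  card_of_mem : ∀ e ∈ edges, e.card = r

variable {r n : ℕ}

/-- The density of the subgraph `G[W]` induced by `W`: the number of edges of `G` contained in `W`,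
divided by the number `(|W| choose r)` of all `r`-subsets of `W`. -/
noncomputable def RGraph.densityOn {V : Type*} [DecidableEq V] (G : RGraph r V) (W : Finset V) : ℝ :=
  ((G.edges.filter (fun e => e ⊆ W)).card : ℝ) / (W.card.choose r : ℝ)

/-- The density `|E(G)| / (n choose r)` of an `r`-graph on the vertex set `Fin n`. -/
noncomputable def RGraph.density (G : RGraph r (Fin n)) : ℝ :=
  (G.edges.card : ℝ) / (n.choose r : ℝ)

/-- `G` is `(ε, p)`-quasi-random: its density is exactly `p`, and the density of `G[W]` lies in the
open interval `(p - ε, p + ε)` for every set `W` of exactly `⌊n / 2⌋` vertices. -/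
def RGraph.IsQuasiRandom (G : RGraph r (Fin n)) (ε p : ℝ) : Prop :=
  G.density = p ∧
    ∀ W : Finset (Fin n), W.card = n / 2 → G.densityOn W ∈ Set.Ioo (p - ε) (p + ε)

/-- For a permutation `v₀, …, vₙ₋₁` of the vertices, the set `{vᵢ, vᵢ₊₁, …, vᵢ₊ᵣ₋₁}`, where indices
are taken modulo `n`. -/
def window (r : ℕ) (v : Equiv.Perm (Fin n)) (i : Fin n) : Finset (Fin n) :=
  (Finset.range r).image (fun j => v ⟨(i.val + j) % n, Nat.mod_lt _ i.pos⟩)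

/-- The set of the `n` cyclically consecutive windows of a permutation of the vertices. -/
def cycleEdges (r : ℕ) (v : Equiv.Perm (Fin n)) : Finset (Finset (Fin n)) :=
  Finset.univ.image (window r v)

/-- The Hamiltonian cycles of `G`. A Hamiltonian cycle is identified with its set of edges, so that
permutations with the same set of windows give the same cycle. -/
def RGraph.hamCycles (G : RGraph r (Fin n)) : Finset (Finset (Finset (Fin n))) :=
  (Finset.univ.image (cycleEdges (n := n) r)).filter (fun C => C ⊆ G.edges)

/-- `H(G)`, the number of Hamiltonian cycles of `G`. -/
def RGraph.numHamCycles (G : RGraph r (Fin n)) : ℕ :=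
  G.hamCycles.card

/-- `H_r(n, p, ε)`: the maximum of `H(G)` over all `(ε, p)`-quasi-random `r`-graphs `G` on `n`
vertices. The set is finite, so the supremum is attained as soon as there is such a `G`; the value
is `0` if there is none. -/
noncomputable def maxHamCycles (r n : ℕ) (p ε : ℝ) : ℕ :=
  sSup {h : ℕ | ∃ G : RGraph r (Fin n), G.IsQuasiRandom ε p ∧ G.numHamCycles = h}

/-- The expectation value `E(n, p) = pⁿ (n - 1)! / 2`. -/
noncomputable def expectedHamCycles (n : ℕ) (p : ℝ) : ℝ :=
  p ^ n * ((n - 1).factorial : ℝ) / 2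

end HyperHam

/-! The random 3-graph here is a union of large cliques. In a Steiner system `S(3, q+1, q^4+1)`
every triple lies in exactly one block. Choose `m = p|𝓑|` blocks uniformly and take all triples
inside them: the density is exactly `p`, but triples in a common block are present or absent
together.

An ordering of the vertices with `X` overlaps (four consecutive vertices in one block) uses at most
`n - X` blocks, so its cycle survives with probability at least about `p^(n-X)`
(`half_pow_mul_choose_le`). For a random ordering `X` has mean at least `q - 2`, and convexity gives
`E[(1/p)^X] ≥ (1/p)^(q-2)` (`le_sum_pow_overlaps`). Thus the expected number of Hamiltonian cycles
beats `p^n n!` by this factor, up to a polynomial in `n` (`le_sum_numHamCycles`).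

Quasi-randomness fails with probability about `exp(-c ε² q^9)`, since a block contributes at most
order `q^3` triples to a total of order `q^12` (`card_filter_tail_le`). This outweighs both the
union over `2^n` vertex sets and the trivial bound of `n!` cycles in a bad graph, as `n` is only
about `q^4`. So some quasi-random choice attains the average up to the losses (`le_maxHamCycles`).
-/

namespace HyperHam

/-! ### Spherical geometries: Steiner systems from projective lines over finite fields -/

section Steiner

open OnePoint Matrix
open scoped Pointwise

/-- The image of the projective line over a finite subfield. -/
def subline {K L : Type*} [Field K] [Field L] [DecidableEq (OnePoint L)] [Fintype K]
    (f : K →+* L) : Finset (OnePoint L) :=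
  Finset.univ.image (OnePoint.map f)

lemma card_subline {K L : Type*} [Field K] [Field L] [DecidableEq (OnePoint L)] [Fintype K]
    (f : K →+* L) : (subline f).card = Fintype.card K + 1 := by
  have hinj : Function.Injective (OnePoint.map f) := Option.map_injective f.injective
  rw [subline, Finset.card_image_of_injective _ hinj, Finset.card_univ]
  exact Fintype.card_option

variable {K : Type*} [Field K] [DecidableEq K]

lemma exists_gl_smul_infty (a : OnePoint K) : ∃ g : GL (Fin 2) K, g • (∞ : OnePoint K) = a := by
  cases a with
  | infty => exact ⟨1, one_smul _ _⟩
  | coe x =>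
    refine ⟨GeneralLinearGroup.mkOfDetNeZero !![x, -1; 1, 0] (by simp [det_fin_two]), ?_⟩
    rw [smul_infty_eq_ite]
    simp [GeneralLinearGroup.mkOfDetNeZero]

/-- `GL₂` acts transitively on the ordered triples of distinct points of the projective line. -/
lemma exists_gl_smul_triple {a b c : OnePoint K} (hab : a ≠ b) (hac : a ≠ c) (hbc : b ≠ c) :
    ∃ g : GL (Fin 2) K, g • (∞ : OnePoint K) = a ∧ g • ((0 : K) : OnePoint K) = b ∧
      g • ((1 : K) : OnePoint K) = c := by
  obtain ⟨g, rfl⟩ := exists_gl_smul_infty a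
  obtain ⟨b, rfl⟩ : ∃ b', g • b' = b := ⟨g⁻¹ • b, smul_inv_smul _ _⟩
  obtain ⟨c, rfl⟩ : ∃ c', g • c' = c := ⟨g⁻¹ • c, smul_inv_smul _ _⟩
  cases b with
  | infty => exact absurd rfl hab
  | coe x =>
    cases c with
    | infty => exact absurd rfl hac
    | coe y =>
      have hxy : y - x ≠ 0 := fun h => hbc (by rw [sub_eq_zero.mp h])
      refine ⟨g * GeneralLinearGroup.mkOfDetNeZero !![y - x, x; 0, 1]
        (by simpa [det_fin_two] using hxy), ?_, ?_, ?_⟩ <;>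
      rw [mul_smul]
      · rw [smul_infty_eq_self_iff.mpr]
        simp [GeneralLinearGroup.mkOfDetNeZero]
      · rw [smul_some_eq_ite]
        simp [GeneralLinearGroup.mkOfDetNeZero]
      · rw [smul_some_eq_ite]
        simp [GeneralLinearGroup.mkOfDetNeZero]

/-- Fixing `∞` makes the matrix upper triangular, fixing `0` makes it diagonal, and fixing `1` makes
it scalar. -/
lemma gl_smul_eq_self_of_triple {h : GL (Fin 2) K} (h₁ : h • (∞ : OnePoint K) = ∞)
    (h₂ : h • ((0 : K) : OnePoint K) = (0 : K)) (h₃ : h • ((1 : K) : OnePoint K) = (1 : K))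
    (x : OnePoint K) : h • x = x := by
  cases x with
  | infty => exact h₁
  | coe k =>
    rw [smul_infty_eq_self_iff] at h₁
    rw [smul_some_eq_ite] at h₂ h₃ ⊢
    have h11 : h 1 1 ≠ 0 := by
      intro h0
      simp [h₁, h0] at h₂
    simp only [h₁, mul_zero, zero_add, zero_mul, h11, if_false, coe_eq_coe, mul_one] at h₂ h₃ ⊢
    have h01 : h 0 1 = 0 := by simpa [h11] using h₂
    have h00 : h 0 0 = h 1 1 := by
      rw [h01, add_zero] at h₃
      exact (div_eq_one_iff_eq h11).mp h₃
    rw [h01, h00, add_zero, mul_div_cancel_left₀ _ h11]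

variable {L : Type*} [Field L] [DecidableEq L] [DecidableEq (OnePoint L)] [Fintype K]

/-- Three distinct points of the projective line over `L` lie in exactly one translate of the
projective line over a subfield. -/
lemma existsUnique_smul_subline (f : K →+* L) {a b c : OnePoint L} (hab : a ≠ b) (hac : a ≠ c)
    (hbc : b ≠ c) :
    ∃! B : Finset (OnePoint L), (∃ g : GL (Fin 2) L, B = g • subline f) ∧ a ∈ B ∧ b ∈ B ∧ c ∈ B := by
  have f0 : OnePoint.map f ((0 : K) : OnePoint K) = ((0 : L) : OnePoint L) := by simp
  have f1 : OnePoint.map f ((1 : K) : OnePoint K) = ((1 : L) : OnePoint L) := by simp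
  have fi : OnePoint.map f (∞ : OnePoint K) = (∞ : OnePoint L) := by simp
  obtain ⟨g, rfl, rfl, rfl⟩ := exists_gl_smul_triple hab hac hbc
  refine ⟨g • subline f, ⟨⟨g, rfl⟩, ?_, ?_, ?_⟩, ?_⟩
  · exact Finset.smul_mem_smul_finset (Finset.mem_image.mpr ⟨_, Finset.mem_univ _, fi⟩)
  · exact Finset.smul_mem_smul_finset (Finset.mem_image.mpr ⟨_, Finset.mem_univ _, f0⟩)
  · exact Finset.smul_mem_smul_finset (Finset.mem_image.mpr ⟨_, Finset.mem_univ _, f1⟩)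
  rintro _ ⟨⟨g', rfl⟩, ha, hb, hc⟩
  obtain ⟨_, ha', ha⟩ := Finset.mem_smul_finset.mp ha
  obtain ⟨_, hb', hb⟩ := Finset.mem_smul_finset.mp hb
  obtain ⟨_, hc', hc⟩ := Finset.mem_smul_finset.mp hc
  obtain ⟨a, -, rfl⟩ := Finset.mem_image.mp ha'
  obtain ⟨b, -, rfl⟩ := Finset.mem_image.mp hb'
  obtain ⟨c, -, rfl⟩ := Finset.mem_image.mp hc'
  rw [← ha, ← hb] at hab
  rw [← ha, ← hc] at hac
  rw [← hb, ← hc] at hbc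
  obtain ⟨k, rfl, rfl, rfl⟩ := exists_gl_smul_triple (a := a) (b := b) (c := c)
    (fun h => hab (by rw [h])) (fun h => hac (by rw [h])) (fun h => hbc (by rw [h]))
  rw [OnePoint.map_smul, fi, smul_smul] at ha
  rw [OnePoint.map_smul, f0, smul_smul] at hb
  rw [OnePoint.map_smul, f1, smul_smul] at hc
  -- Both transformations agree on `∞`, `0` and `1`, hence everywhere; and `k`, having entries in
  -- the subfield, preserves the subline.
  have key : ∀ x : OnePoint L, g • x = (g' * k.map f) • x := by
    intro x
    rw [← inv_smul_eq_iff, smul_smul]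
    rw [← eq_inv_smul_iff, smul_smul] at ha hb hc
    exact gl_smul_eq_self_of_triple ha.symm hb.symm hc.symm x
  have hsub : k.map f • subline f = subline f := by
    apply Finset.eq_of_subset_of_card_le
    · intro x hx
      obtain ⟨_, hy, rfl⟩ := Finset.mem_smul_finset.mp hx
      obtain ⟨y, -, rfl⟩ := Finset.mem_image.mp hy
      rw [← OnePoint.map_smul]
      exact Finset.mem_image_of_mem _ (Finset.mem_univ _)
    · rw [Finset.card_smul_finset]
  have : g • subline f = (g' * k.map f) • subline f := by
    ext x
    simp only [Finset.mem_smul_finset, key]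
  rw [this, mul_smul, hsub]

end Steiner

/-- A Steiner system `S(3, k, v)` on the point set `V`. -/
def IsSteinerTriple {V : Type*} (k : ℕ) (𝓑 : Finset (Finset V)) : Prop :=
  (∀ B ∈ 𝓑, B.card = k) ∧ ∀ e : Finset V, e.card = 3 → ∃! B, B ∈ 𝓑 ∧ e ⊆ B

/-- The spherical geometries `S(3, q + 1, q⁴ + 1)`. -/
theorem exists_isSteinerTriple {q : ℕ} (hq : IsPrimePow q) :
    ∃ 𝓑 : Finset (Finset (Fin (q ^ 4 + 1))), IsSteinerTriple (q + 1) 𝓑 := by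
  classical
  obtain ⟨p, k, hp, hk, rfl⟩ := (isPrimePow_nat_iff q).mp hq
  have : Fact p.Prime := ⟨hp⟩
  let K := GaloisField p k
  let L := FiniteField.Extension K p 4
  have : Finite L := Module.finite_of_finite K
  let _ : Fintype K := Fintype.ofFinite K
  let _ : Fintype L := Fintype.ofFinite L
  have hK : Fintype.card K = p ^ k := by
    rw [← Nat.card_eq_fintype_card]; exact GaloisField.card p k hk.ne'
  have hL : Fintype.card L = (p ^ k) ^ 4 := by
    rw [← Nat.card_eq_fintype_card, FiniteField.natCard_extension, GaloisField.card p k hk.ne']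
  have hcard : Fintype.card (OnePoint L) = (p ^ k) ^ 4 + 1 := by
    rw [← hL]; exact Fintype.card_option
  let φ : OnePoint L ≃ Fin ((p ^ k) ^ 4 + 1) := Fintype.equivFinOfCardEq hcard
  let f : K →+* L := algebraMap K L
  let P : Finset (Fin ((p ^ k) ^ 4 + 1)) → Prop := fun B =>
    ∃ g : Matrix.GeneralLinearGroup (Fin 2) L,
      B = ((subline f).image (fun x => g • x)).map φ.toEmbedding
  refine ⟨Finset.univ.filter P, ?_, ?_⟩
  · intro B hB
    obtain ⟨g, rfl⟩ := (Finset.mem_filter.mp hB).2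
    rw [Finset.card_map, Finset.card_image_of_injective _ (MulAction.injective g), card_subline, hK]
  · intro e he
    obtain ⟨a, b, c, hab, hac, hbc, rfl⟩ := Finset.card_eq_three.mp he
    obtain ⟨B, ⟨⟨g, hg⟩, ha, hb, hc⟩, huniq⟩ := existsUnique_smul_subline f
      (φ.symm.injective.ne hab) (φ.symm.injective.ne hac) (φ.symm.injective.ne hbc)
    refine ⟨B.map φ.toEmbedding, ⟨?_, ?_⟩, ?_⟩
    · exact Finset.mem_filter.mpr ⟨Finset.mem_univ _, g, by rw [hg]; rfl⟩
    · intro x hx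
      rw [Finset.mem_map_equiv]
      simp only [Finset.mem_insert, Finset.mem_singleton] at hx
      rcases hx with rfl | rfl | rfl <;> assumption
    · rintro B' ⟨hB', hsub⟩
      obtain ⟨g', rfl⟩ := (Finset.mem_filter.mp hB').2
      rw [← huniq ((subline f).image (fun x => g' • x))]
      have hmem : ∀ x ∈ ({a, b, c} : Finset _),
          φ.symm x ∈ (subline f).image (fun x => g' • x) :=
        fun x hx => (Finset.mem_map_equiv (f := φ)).mp (hsub hx)
      exact ⟨⟨g', rfl⟩, hmem a (by simp), hmem b (by simp), hmem c (by simp)⟩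

/-! ### Tight Hamiltonian cycles and vertex orderings -/

section Cycles

variable {n : ℕ} [NeZero n]

/-- The cyclic sequence of vertices `v₀, v₁, …`, with indices modulo `n`. -/
def cyc (v : Equiv.Perm (Fin n)) (i : ℕ) : Fin n := v (Fin.ofNat n i)

lemma cyc_eq_iff {v : Equiv.Perm (Fin n)} {i j : ℕ} : cyc v i = cyc v j ↔ i ≡ j [MOD n] := by
  rw [cyc, cyc, v.injective.eq_iff, Fin.ext_iff]
  rfl

lemma cyc_add_ne {v : Equiv.Perm (Fin n)} (i : ℕ) {s t : ℕ} (hs : s < n) (ht : t < n)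
    (hst : s ≠ t) : cyc v (i + s) ≠ cyc v (i + t) := by
  rw [Ne, cyc_eq_iff]
  intro h
  exact hst ((Nat.ModEq.add_left_cancel' i h).eq_of_lt_of_lt hs ht)

lemma cyc_val (v : Equiv.Perm (Fin n)) (i : Fin n) : cyc v i = v i := by
  simp [cyc]

/-- Three cyclically consecutive vertices. -/
def cycWindow (v : Equiv.Perm (Fin n)) (i : ℕ) : Finset (Fin n) :=
  {cyc v i, cyc v (i + 1), cyc v (i + 2)}

lemma window_eq (v : Equiv.Perm (Fin n)) (i : Fin n) : window 3 v i = cycWindow v i := by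
  ext x
  simp [window, cycWindow, Finset.range_add_one, cyc, Fin.ofNat]
  tauto

lemma cycWindow_mod (v : Equiv.Perm (Fin n)) (i : ℕ) :
    cycWindow v (Fin.ofNat n i) = cycWindow v i := by
  have h : ((Fin.ofNat n i : Fin n) : ℕ) ≡ i [MOD n] := Nat.mod_modEq i n
  simp only [cycWindow, cyc_eq_iff.mpr h, cyc_eq_iff.mpr (h.add_right 1),
    cyc_eq_iff.mpr (h.add_right 2)]

lemma mem_cycleEdges {v : Equiv.Perm (Fin n)} {e : Finset (Fin n)} :
    e ∈ cycleEdges 3 v ↔ ∃ i : ℕ, cycWindow v i = e := by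
  simp only [cycleEdges, Finset.mem_image, Finset.mem_univ, true_and, window_eq]
  constructor
  · rintro ⟨i, rfl⟩
    exact ⟨i, rfl⟩
  · rintro ⟨i, rfl⟩
    exact ⟨Fin.ofNat n i, cycWindow_mod v i⟩

lemma card_cycWindow (hn : 3 ≤ n) (v : Equiv.Perm (Fin n)) (i : ℕ) : (cycWindow v i).card = 3 := by
  have h01 := cyc_add_ne (v := v) i (s := 0) (t := 1) (by omega) (by omega) (by omega)
  have h02 := cyc_add_ne (v := v) i (s := 0) (t := 2) (by omega) (by omega) (by omega)
  have h12 := cyc_add_ne (v := v) i (s := 1) (t := 2) (by omega) (by omega) (by omega)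
  exact Finset.card_eq_three.mpr ⟨_, _, _, h01, h02, h12, rfl⟩

/-- A tight Hamiltonian cycle of triples together with three consecutive vertices of an ordering
determines the ordering. -/
lemma eq_of_cycleEdges_eq (hn : 6 ≤ n) {v w : Equiv.Perm (Fin n)}
    (h : cycleEdges 3 v = cycleEdges 3 w) (h0 : cyc v 0 = cyc w 0) (h1 : cyc v 1 = cyc w 1)
    (h2 : cyc v 2 = cyc w 2) : v = w := by
  have key : ∀ i, cyc v i = cyc w i ∧ cyc v (i + 1) = cyc w (i + 1) ∧
      cyc v (i + 2) = cyc w (i + 2) := by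
    intro i
    induction i with
    | zero => exact ⟨h0, h1, h2⟩
    | succ i ih =>
      obtain ⟨e0, e1, e2⟩ := ih
      refine ⟨e1, e2, ?_⟩
      have hw : cycWindow w (i + 1) ∈ cycleEdges 3 v := by
        rw [h]; exact mem_cycleEdges.mpr ⟨_, rfl⟩
      obtain ⟨j, hj⟩ := mem_cycleEdges.mp hw
      have m1 : cyc v (i + 1) ∈ cycWindow v j := by rw [hj, e1]; simp [cycWindow]
      have m2 : cyc v (i + 2) ∈ cycWindow v j := by rw [hj, e2]; simp [cycWindow]
      have m3 : cyc w (i + 3) ∈ cycWindow v j := by rw [hj]; simp [cycWindow]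
      have n1 : cyc w (i + 3) ≠ cyc w (i + 1) :=
        cyc_add_ne i (by omega) (by omega) (by omega)
      have n2 : cyc w (i + 3) ≠ cyc w (i + 2) :=
        cyc_add_ne i (by omega) (by omega) (by omega)
      have n0 : cyc w (i + 3) ≠ cyc w i :=
        cyc_add_ne i (s := 3) (t := 0) (by omega) (by omega) (by omega)
      simp only [cycWindow, Finset.mem_insert, Finset.mem_singleton] at m1 m2 m3
      -- Where does `v (i + 1)` sit in window `j`? If first, the window ends in `v (i + 3)`, which
      -- must be `w (i + 3)`. If in the middle, the window consists of three vertices shared with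
      -- `w`, none equal to `w (i + 3)`. If last, `v (i + 2)` falls outside the window.
      rcases m1 with m1 | m1 | m1
      · have a1 : cyc v (i + 2) = cyc v (j + 1) := cyc_eq_iff.mpr ((cyc_eq_iff.mp m1).add_right 1)
        have a2 : cyc v (i + 3) = cyc v (j + 2) := cyc_eq_iff.mpr ((cyc_eq_iff.mp m1).add_right 2)
        rw [← m1, ← a1, ← a2, e1, e2] at m3
        rcases m3 with m3 | m3 | m3
        · exact absurd m3 n1
        · exact absurd m3 n2
        · exact m3.symm
      · have a0 : cyc v i = cyc v j :=
          cyc_eq_iff.mpr (Nat.ModEq.add_right_cancel' 1 (cyc_eq_iff.mp m1))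
        have a2 : cyc v (i + 2) = cyc v (j + 2) := cyc_eq_iff.mpr ((cyc_eq_iff.mp m1).add_right 1)
        rw [← m1, ← a0, ← a2, e0, e1, e2] at m3
        rcases m3 with m3 | m3 | m3
        · exact absurd m3 n0
        · exact absurd m3 n1
        · exact absurd m3 n2
      · have a3 : cyc v (i + 2) = cyc v (j + 3) := cyc_eq_iff.mpr ((cyc_eq_iff.mp m1).add_right 1)
        rw [a3] at m2
        rcases m2 with m2 | m2 | m2
        · exact absurd m2 (cyc_add_ne j (s := 3) (t := 0) (by omega) (by omega) (by omega))
        · exact absurd m2 (cyc_add_ne j (by omega) (by omega) (by omega))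
        · exact absurd m2 (cyc_add_ne j (by omega) (by omega) (by omega))
  ext i
  rw [← cyc_val v i, ← cyc_val w i, (key i).1]

/-- The first three vertices determine the ordering once the cycle is known. This crude polynomial
bound suffices, because the gain is exponential in `n^(1/4)`. -/
lemma card_filter_cycleEdges_eq_le (hn : 6 ≤ n) (s : Finset (Equiv.Perm (Fin n)))
    (C : Finset (Finset (Fin n))) :
    (s.filter (fun v => cycleEdges 3 v = C)).card ≤ n ^ 3 := by
  have hinj : Set.InjOn (fun v : Equiv.Perm (Fin n) => (cyc v 0, cyc v 1, cyc v 2))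
      (s.filter (fun v => cycleEdges 3 v = C)) := by
    intro v hv w hw hvw
    have hv' := (Finset.mem_filter.mp hv).2
    have hw' := (Finset.mem_filter.mp hw).2
    simp only [Prod.mk.injEq] at hvw
    exact eq_of_cycleEdges_eq hn (hv'.trans hw'.symm) hvw.1 hvw.2.1 hvw.2.2
  have := Finset.card_le_card_of_injOn _ (fun _ _ => Finset.mem_univ _) hinj
  refine this.trans (le_of_eq ?_)
  simp [Finset.card_univ, Fintype.card_prod]
  ring

lemma card_perms_le_numHamCycles (hn : 6 ≤ n) (G : RGraph 3 (Fin n)) :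
    (Finset.univ.filter (fun v : Equiv.Perm (Fin n) => cycleEdges 3 v ⊆ G.edges)).card ≤
      n ^ 3 * G.numHamCycles := by
  refine (Finset.card_le_mul_card_image (f := cycleEdges 3) _ (n ^ 3)
    (fun C _ => card_filter_cycleEdges_eq_le hn _ C)).trans ?_
  refine Nat.mul_le_mul_left _ (Finset.card_le_card ?_)
  intro C hC
  obtain ⟨v, hv, rfl⟩ := Finset.mem_image.mp hC
  exact Finset.mem_filter.mpr ⟨Finset.mem_image_of_mem _ (Finset.mem_univ _),
    (Finset.mem_filter.mp hv).2⟩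

omit [NeZero n] in
lemma numHamCycles_le_factorial {r : ℕ} (G : RGraph r (Fin n)) :
    G.numHamCycles ≤ n.factorial := by
  refine (Finset.card_filter_le _ _).trans (Finset.card_image_le.trans ?_)
  rw [Finset.card_univ, Fintype.card_perm, Fintype.card_fin]

omit [NeZero n] in
lemma numHamCycles_le_maxHamCycles {r : ℕ} {p ε : ℝ} {G : RGraph r (Fin n)}
    (hG : G.IsQuasiRandom ε p) : G.numHamCycles ≤ maxHamCycles r n p ε := by
  refine le_csSup ⟨n.factorial, ?_⟩ ⟨G, hG, rfl⟩
  rintro _ ⟨G, -, rfl⟩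
  exact numHamCycles_le_factorial G

end Cycles

/-! ### Blocks met by a cycle, and the mean number of overlaps -/

section Overlap

variable {n k : ℕ} {𝓑 : Finset (Finset (Fin n))}

open Classical in
/-- The block of a Steiner system through a given triple (and `∅` for sets that are not triples). -/
noncomputable def IsSteinerTriple.block {V : Type*} {𝓑 : Finset (Finset V)}
    (h : IsSteinerTriple k 𝓑) (e : Finset V) : Finset V :=
  if he : e.card = 3 then (h.2 e he).choose else ∅

lemma IsSteinerTriple.block_spec {V : Type*} {𝓑 : Finset (Finset V)}
    (h : IsSteinerTriple k 𝓑) {e : Finset V} (he : e.card = 3) :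
    h.block e ∈ 𝓑 ∧ e ⊆ h.block e := by
  rw [IsSteinerTriple.block, dif_pos he]
  exact (h.2 e he).choose_spec.1

lemma IsSteinerTriple.eq_block {V : Type*} {𝓑 : Finset (Finset V)}
    (h : IsSteinerTriple k 𝓑) {e B : Finset V} (he : e.card = 3) (hB : B ∈ 𝓑) (heB : e ⊆ B) :
    B = h.block e :=
  (h.2 e he).unique ⟨hB, heB⟩ (h.block_spec he)

variable [NeZero n]

/-- The blocks that contain an edge of the Hamiltonian cycle of `v`. -/
noncomputable def IsSteinerTriple.cycleBlocks (h : IsSteinerTriple k 𝓑) (v : Equiv.Perm (Fin n)) :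
    Finset (Finset (Fin n)) :=
  (cycleEdges 3 v).image h.block

/-- The positions at which two consecutive edges of the Hamiltonian cycle lie in the same block. -/
noncomputable def IsSteinerTriple.overlaps (h : IsSteinerTriple k 𝓑) (v : Equiv.Perm (Fin n)) :
    Finset (Fin n) :=
  Finset.univ.filter (fun i => cyc v (i + 3) ∈ h.block (cycWindow v i))

lemma IsSteinerTriple.block_succ (h : IsSteinerTriple k 𝓑) (hn : 3 ≤ n) {v : Equiv.Perm (Fin n)}
    {i : ℕ} (hi : cyc v (i + 3) ∈ h.block (cycWindow v i)) :
    h.block (cycWindow v i) = h.block (cycWindow v (i + 1)) := by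
  have hs := h.block_spec (card_cycWindow hn v i)
  refine h.eq_block (card_cycWindow hn v _) hs.1 ?_
  intro x hx
  simp only [cycWindow, Finset.mem_insert, Finset.mem_singleton] at hx
  rcases hx with rfl | rfl | rfl
  · exact hs.2 (by simp [cycWindow])
  · exact hs.2 (by simp [cycWindow])
  · exact hi

lemma IsSteinerTriple.mem_overlaps_ofNat (h : IsSteinerTriple k 𝓑) {v : Equiv.Perm (Fin n)}
    {i : ℕ} : Fin.ofNat n i ∈ h.overlaps v ↔ cyc v (i + 3) ∈ h.block (cycWindow v i) := by
  have hm : ((Fin.ofNat n i : Fin n) : ℕ) ≡ i [MOD n] := Nat.mod_modEq i n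
  simp only [overlaps, Finset.mem_filter, Finset.mem_univ, true_and, cycWindow_mod,
    cyc_eq_iff.mpr (hm.add_right 3)]

/-- The block does not change across an overlap, so each block of the cycle is already seen at the
end of a run, that is, at a non-overlap position. -/
lemma IsSteinerTriple.card_cycleBlocks_add_card_overlaps_le (h : IsSteinerTriple k 𝓑)
    (hn : 3 ≤ n) (hk : k < n) (v : Equiv.Perm (Fin n)) :
    (h.cycleBlocks v).card + (h.overlaps v).card ≤ n := by
  have hsub : h.cycleBlocks v ⊆
      (h.overlaps v)ᶜ.image (fun i : Fin n => h.block (cycWindow v i)) := by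
    intro B hB
    obtain ⟨e, he, rfl⟩ := Finset.mem_image.mp hB
    obtain ⟨i, rfl⟩ := mem_cycleEdges.mp he
    by_cases hex : ∃ t, Fin.ofNat n (i + t) ∉ h.overlaps v
    · classical
      have hmin : ∀ t ≤ Nat.find hex, h.block (cycWindow v i) = h.block (cycWindow v (i + t)) := by
        intro t
        induction t with
        | zero => intro _; rfl
        | succ t ih =>
          intro ht
          rw [ih (by omega)]
          exact h.block_succ hn
            (h.mem_overlaps_ofNat.mp (not_not.mp (Nat.find_min hex (by omega : t < _))))
      refine Finset.mem_image.mpr ⟨_, Finset.mem_compl.mpr (Nat.find_spec hex), ?_⟩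
      rw [cycWindow_mod, ← hmin _ le_rfl]
    -- Otherwise the run never ends and a single block contains every vertex, contrary to `k < n`.
    · push Not at hex
      exfalso
      have hall : ∀ t, h.block (cycWindow v i) = h.block (cycWindow v (i + t)) := by
        intro t
        induction t with
        | zero => rfl
        | succ t ih =>
          rw [ih]
          exact h.block_succ hn (h.mem_overlaps_ofNat.mp (hex t))
      have huniv : Finset.univ ⊆ h.block (cycWindow v i) := by
        intro x _
        obtain ⟨y, rfl⟩ := v.surjective x
        -- The offset is chosen so that the index is `n * i + y ≡ y`; the subtraction does not
        -- truncate because `i ≤ n * i`.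
        have hy : cyc v (i + (n * i + y - i)) = v y := by
          rw [← cyc_val v y, cyc_eq_iff]
          have : i + (n * i + y - i) = n * i + y := by
            have := Nat.le_mul_of_pos_left i (show 0 < n by omega)
            omega
          rw [this]
          simp [Nat.ModEq]
        rw [hall (n * i + y - i), ← hy]
        exact (h.block_spec (card_cycWindow hn v _)).2 (by simp [cycWindow])
      have := Finset.card_le_card huniv
      rw [Finset.card_univ, Fintype.card_fin,
        h.1 _ (h.block_spec (card_cycWindow hn v i)).1] at this
      omega
  have h1 := (Finset.card_le_card hsub).trans Finset.card_image_le
  rw [Finset.card_compl, Fintype.card_fin] at h1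
  have h2 := Finset.card_le_univ (h.overlaps v)
  rw [Fintype.card_fin] at h2
  omega

/-- By symmetry the fourth vertex is equally likely to be any of the `n - 3` vertices outside the
window, and `k - 3` of these lie in its block. -/
lemma IsSteinerTriple.card_filter_mem_overlaps (h : IsSteinerTriple k 𝓑) (hn : 4 ≤ n) (i : Fin n) :
    (n - 3) * (Finset.univ.filter (fun v : Equiv.Perm (Fin n) => i ∈ h.overlaps v)).card =
      n.factorial * (k - 3) := by
  classical
  let x (t : ℕ) : Fin n := Fin.ofNat n (i + t)
  have hx : ∀ {s t : ℕ}, s < n → t < n → s ≠ t → x s ≠ x t := fun hs ht hst =>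
    cyc_add_ne (v := 1) i hs ht hst
  let J : Finset (Fin n) := {x 0, x 1, x 2}
  have hJ : J.card = 3 := Finset.card_eq_three.mpr ⟨_, _, _, hx (by omega) (by omega) (by omega),
    hx (by omega) (by omega) (by omega), hx (by omega) (by omega) (by omega), rfl⟩
  have hJw : ∀ v : Equiv.Perm (Fin n), J.image v = cycWindow v i := by
    intro v; simp [J, x, cycWindow, cyc, Finset.image_insert]
  have h3J : x 3 ∉ J := by
    simp only [J, Finset.mem_insert, Finset.mem_singleton, not_or]
    exact ⟨hx (by omega) (by omega) (by omega), hx (by omega) (by omega) (by omega),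
      hx (by omega) (by omega) (by omega)⟩
  -- Precomposing with the transposition of positions `x 3` and `j` leaves the window, and so its
  -- block, unchanged.
  have hswap : ∀ j ∈ Jᶜ, (Finset.univ.filter (fun v : Equiv.Perm (Fin n) => i ∈ h.overlaps v)).card =
      (Finset.univ.filter (fun v : Equiv.Perm (Fin n) => v j ∈ h.block (cycWindow v i))).card := by
    intro j hj
    have hj := Finset.mem_compl.mp hj
    refine Finset.card_equiv (Equiv.mulRight (Equiv.swap (x 3) j)) ?_
    intro v
    have hw : cycWindow (v * Equiv.swap (x 3) j) i = cycWindow v i := by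
      rw [← hJw, ← hJw]
      refine Finset.image_congr ?_
      intro a ha
      rw [Equiv.Perm.mul_apply, Equiv.swap_apply_of_ne_of_ne]
      · rintro rfl; exact h3J ha
      · rintro rfl; exact hj ha
    simp only [IsSteinerTriple.overlaps, Finset.mem_filter, Finset.mem_univ, true_and,
      Equiv.coe_mulRight, hw, Equiv.Perm.mul_apply, Equiv.swap_apply_right]
    rfl
  have hcount : ∀ v : Equiv.Perm (Fin n),
      (Jᶜ.filter (fun j => v j ∈ h.block (cycWindow v i))).card = k - 3 := by
    intro v
    have hs := h.block_spec (card_cycWindow (by omega) v i)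
    have : (Jᶜ.filter (fun j => v j ∈ h.block (cycWindow v i))).map v.toEmbedding =
        h.block (cycWindow v i) \ cycWindow v i := by
      ext y
      rw [Finset.mem_map_equiv, Finset.mem_filter, Finset.mem_sdiff, Equiv.apply_symm_apply,
        Finset.mem_compl, ← hJw v, and_comm]
      refine and_congr_right fun _ => not_congr ?_
      rw [Finset.mem_image]
      constructor
      · intro hy
        exact ⟨_, hy, v.apply_symm_apply y⟩
      · rintro ⟨a, ha, rfl⟩
        rwa [Equiv.symm_apply_apply]
    rw [← Finset.card_map v.toEmbedding, this, Finset.card_sdiff_of_subset hs.2, h.1 _ hs.1,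
      card_cycWindow (by omega)]
  calc (n - 3) * (Finset.univ.filter (fun v : Equiv.Perm (Fin n) => i ∈ h.overlaps v)).card
      = ∑ j ∈ Jᶜ, (Finset.univ.filter
          (fun v : Equiv.Perm (Fin n) => v j ∈ h.block (cycWindow v i))).card := by
        rw [← Finset.sum_congr rfl hswap, Finset.sum_const, Finset.card_compl, hJ,
          Fintype.card_fin, smul_eq_mul]
    _ = ∑ v : Equiv.Perm (Fin n), (Jᶜ.filter (fun j => v j ∈ h.block (cycWindow v i))).card :=
        Finset.sum_card_bipartiteAbove_eq_sum_card_bipartiteBelow _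
    _ = n.factorial * (k - 3) := by
        simp only [hcount, Finset.sum_const, Finset.card_univ, Fintype.card_perm, Fintype.card_fin,
          smul_eq_mul]

lemma IsSteinerTriple.le_sum_card_overlaps (h : IsSteinerTriple k 𝓑) (hn : 4 ≤ n) :
    n.factorial * (k - 3) ≤ ∑ v : Equiv.Perm (Fin n), (h.overlaps v).card := by
  have hsum : ∑ v : Equiv.Perm (Fin n), (h.overlaps v).card =
      ∑ i : Fin n, (Finset.univ.filter (fun v : Equiv.Perm (Fin n) => i ∈ h.overlaps v)).card := by
    have := Finset.sum_card_bipartiteAbove_eq_sum_card_bipartiteBelow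
      (fun (v : Equiv.Perm (Fin n)) i => i ∈ h.overlaps v) (s := Finset.univ) (t := Finset.univ)
    simpa [Finset.bipartiteAbove, Finset.bipartiteBelow] using this
  have h1 : (n - 3) * ∑ v : Equiv.Perm (Fin n), (h.overlaps v).card =
      n * (n.factorial * (k - 3)) := by
    rw [hsum, Finset.mul_sum, Finset.sum_congr rfl fun i _ => h.card_filter_mem_overlaps hn i,
      Finset.sum_const, Finset.card_univ, Fintype.card_fin, smul_eq_mul]
  have h2 : (n - 3) * (n.factorial * (k - 3)) ≤ n * (n.factorial * (k - 3)) :=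
    Nat.mul_le_mul_right _ (Nat.sub_le _ _)
  exact Nat.le_of_mul_le_mul_left (h2.trans h1.ge) (by omega)

end Overlap

/-! ### Edge counts in unions of blocks -/

section BlockGraph

variable {n k : ℕ} {𝓑 : Finset (Finset (Fin n))}

/-- The `3`-graph whose edges are the triples lying in the blocks of `S`. -/
noncomputable def IsSteinerTriple.blockGraph (h : IsSteinerTriple k 𝓑)
    (S : Finset (Finset (Fin n))) : RGraph 3 (Fin n) where
  edges := (Finset.univ.powersetCard 3).filter (fun e => h.block e ∈ S)
  card_of_mem _ he := (Finset.mem_powersetCard.mp (Finset.mem_filter.mp he).1).2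

lemma IsSteinerTriple.mem_edges_blockGraph (h : IsSteinerTriple k 𝓑)
    {S : Finset (Finset (Fin n))} {e : Finset (Fin n)} :
    e ∈ (h.blockGraph S).edges ↔ e.card = 3 ∧ h.block e ∈ S := by
  simp [blockGraph]

/-- Each triple belongs to exactly one block, so edges can be counted block by block. This makes the
edge count in `W` a sum over the chosen blocks, to which a tail bound applies. -/
lemma IsSteinerTriple.card_edges_filter_subset (h : IsSteinerTriple k 𝓑)
    {S : Finset (Finset (Fin n))} (hS : S ⊆ 𝓑) (W : Finset (Fin n)) :
    ((h.blockGraph S).edges.filter (fun e => e ⊆ W)).card = ∑ B ∈ S, (B ∩ W).card.choose 3 := by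
  rw [Finset.card_eq_sum_card_fiberwise (f := h.block) (t := S)]
  · refine Finset.sum_congr rfl fun B hB => ?_
    rw [← Finset.card_powersetCard]
    congr 1
    ext e
    simp only [Finset.mem_filter, h.mem_edges_blockGraph, Finset.mem_powersetCard,
      Finset.subset_inter_iff]
    constructor
    · rintro ⟨⟨⟨he, -⟩, heW⟩, rfl⟩
      exact ⟨⟨(h.block_spec he).2, heW⟩, he⟩
    · rintro ⟨⟨heB, heW⟩, he⟩
      have := h.eq_block he (hS hB) heB
      exact ⟨⟨⟨he, this ▸ hB⟩, heW⟩, this.symm⟩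
  · intro e he
    exact (h.mem_edges_blockGraph.mp (Finset.mem_filter.mp he).1).2

lemma IsSteinerTriple.sum_choose_inter (h : IsSteinerTriple k 𝓑) (W : Finset (Fin n)) :
    ∑ B ∈ 𝓑, (B ∩ W).card.choose 3 = W.card.choose 3 := by
  rw [← h.card_edges_filter_subset (Finset.Subset.refl _) W, ← Finset.card_powersetCard]
  congr 1
  ext e
  simp only [Finset.mem_filter, h.mem_edges_blockGraph, Finset.mem_powersetCard]
  constructor
  · rintro ⟨⟨he, -⟩, heW⟩
    exact ⟨heW, he⟩
  · rintro ⟨heW, he⟩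
    exact ⟨⟨he, (h.block_spec he).1⟩, heW⟩

lemma IsSteinerTriple.card_edges_blockGraph (h : IsSteinerTriple k 𝓑)
    {S : Finset (Finset (Fin n))} (hS : S ⊆ 𝓑) :
    (h.blockGraph S).edges.card = S.card * k.choose 3 := by
  have := h.card_edges_filter_subset hS Finset.univ
  simp only [Finset.subset_univ, Finset.filter_true, Finset.inter_univ] at this
  rw [this, Finset.sum_congr rfl fun B hB => by rw [h.1 B (hS hB)], Finset.sum_const, smul_eq_mul]

lemma IsSteinerTriple.card_mul_choose (h : IsSteinerTriple k 𝓑) :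
    𝓑.card * k.choose 3 = n.choose 3 := by
  have := h.sum_choose_inter Finset.univ
  simp only [Finset.inter_univ, Finset.card_univ, Fintype.card_fin] at this
  rw [← this, Finset.sum_congr rfl fun B hB => by rw [h.1 B hB], Finset.sum_const, smul_eq_mul]

lemma IsSteinerTriple.card_eq {q : ℕ} (hq : 2 ≤ q) {𝓑 : Finset (Finset (Fin (q ^ 4 + 1)))}
    (h : IsSteinerTriple (q + 1) 𝓑) : 𝓑.card = q ^ 3 * (q ^ 6 + q ^ 4 + q ^ 2 + 1) := by
  have h0 := h.card_mul_choose
  have h1 := Nat.descFactorial_eq_factorial_mul_choose (q + 1) 3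
  have h2 := Nat.descFactorial_eq_factorial_mul_choose (q ^ 4 + 1) 3
  -- Writing `q = r + 1` and `q ^ 4 = s + 1` removes truncated subtraction from the falling
  -- factorials.
  obtain ⟨r, rfl⟩ : ∃ r, q = r + 1 := ⟨q - 1, by omega⟩
  obtain ⟨s, hs⟩ : ∃ s, (r + 1) ^ 4 = s + 1 := ⟨(r + 1) ^ 4 - 1, by
    have : 0 < (r + 1) ^ 4 := by positivity
    omega⟩
  simp only [hs, Nat.descFactorial_succ, Nat.descFactorial_zero] at h0 h1 h2
  norm_num [Nat.factorial] at h1 h2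
  have hr : 0 < r * (r + 1) * (r + 2) := by
    have : 0 < r := by omega
    positivity
  refine Nat.eq_of_mul_eq_mul_right hr ?_
  have e1 : 𝓑.card * (r * (r + 1) * (r + 2)) = s * (s + 1) * (s + 2) := by
    have e3 : 𝓑.card * (6 * (r + 1 + 1).choose 3) = 6 * (s + 1 + 1).choose 3 := by
      rw [← h0]; ring
    rw [← h1, ← h2, show r + 1 + 1 - 2 = r by omega, show s + 1 + 1 - 2 = s by omega] at e3
    linarith
  zify at *
  have hs' : (s : ℤ) = (r + 1) ^ 4 - 1 := by linarith
  rw [e1, hs']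
  ring

lemma IsSteinerTriple.density_blockGraph (h : IsSteinerTriple k 𝓑) (hk : 3 ≤ k) (hkn : k ≤ n)
    {S : Finset (Finset (Fin n))} (hS : S ⊆ 𝓑) {p : ℝ} (hp : p * 𝓑.card = S.card) :
    (h.blockGraph S).density = p := by
  have hc : 0 < n.choose 3 := Nat.choose_pos (hk.trans hkn)
  rw [RGraph.density, h.card_edges_blockGraph hS, div_eq_iff (by positivity), ← h.card_mul_choose]
  push_cast
  rw [← hp]
  ring

end BlockGraph

/-! ### Probability that a random `m`-set contains a given set -/

section SubsetCounts

lemma pow_mul_choose_le {M m a b : ℕ} (hab : a ≤ b) (hbm : b ≤ m) (hmM : m ≤ M) :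
    (m - b) ^ a * M.choose m ≤ M ^ a * (M - a).choose (m - a) := by
  induction a with
  | zero => simp
  | succ a ih =>
    have hrec : (M - a) * (M - (a + 1)).choose (m - (a + 1)) = (m - a) * (M - a).choose (m - a) := by
      have := Nat.add_one_mul_choose_eq (M - (a + 1)) (m - (a + 1))
      rw [show M - (a + 1) + 1 = M - a by omega, show m - (a + 1) + 1 = m - a by omega] at this
      rw [this, mul_comm]
    calc (m - b) ^ (a + 1) * M.choose m = (m - b) * ((m - b) ^ a * M.choose m) := by ring
      _ ≤ (m - a) * (M ^ a * (M - a).choose (m - a)) :=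
          Nat.mul_le_mul (by omega) (ih (by omega))
      _ = M ^ a * ((M - a) * (M - (a + 1)).choose (m - (a + 1))) := by rw [hrec]; ring
      _ ≤ M ^ a * (M * (M - (a + 1)).choose (m - (a + 1))) := by gcongr; omega
      _ = M ^ (a + 1) * (M - (a + 1)).choose (m - (a + 1)) := by ring

/-- Sampling without replacement gives at least `((m - b) / M)^a = p^a (1 - b/m)^a`, and Bernoulli's
inequality bounds the last factor below by `1 - ab/m ≥ 1/2`. -/
lemma half_pow_mul_choose_le {M m a b : ℕ} {p : ℝ} (hp : 0 ≤ p) (hab : a ≤ b)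
    (hb : 2 * b ^ 2 ≤ m) (hm : p * M = m) (hmM : m ≤ M) :
    p ^ a / 2 * M.choose m ≤ (M - a).choose (m - a) := by
  rcases Nat.eq_zero_or_pos m with rfl | hm0
  · have : b = 0 := by nlinarith
    subst this
    obtain rfl : a = 0 := by omega
    norm_num
  have hbm : b ≤ m := by nlinarith
  have hM0 : 0 < M := by omega
  have hm0' : (0 : ℝ) < m := by exact_mod_cast hm0
  have hM0' : (0 : ℝ) < M := by exact_mod_cast hM0
  have hb' : 2 * (b : ℝ) ^ 2 ≤ m := by exact_mod_cast hb
  have hb1 : (b : ℝ) ≤ m := by exact_mod_cast hbm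
  have hab' : (a : ℝ) ≤ b := by exact_mod_cast hab
  have h1 : ((m : ℝ) - b) ^ a * M.choose m ≤ M ^ a * (M - a).choose (m - a) := by
    have := pow_mul_choose_le hab hbm hmM
    rw [← Nat.cast_sub hbm]
    exact_mod_cast this
  have h2 : (1 : ℝ) / 2 ≤ (1 - b / m) ^ a := by
    have hle : (b : ℝ) / m ≤ 1 := by rw [div_le_one hm0']; exact hb1
    have := one_add_mul_le_pow (a := -((b : ℝ) / m)) (by linarith) a
    refine le_trans ?_ (this.trans (le_of_eq (by ring)))
    have : (a : ℝ) * (b / m) ≤ 1 / 2 := by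
      rw [mul_div_assoc', div_le_iff₀ hm0']
      nlinarith
    linarith
  have h3 : p ^ a / 2 * M ^ a ≤ ((m : ℝ) - b) ^ a := by
    have e : ((m : ℝ) - b) = p * M * (1 - b / m) := by
      rw [hm]; field_simp
    rw [e, mul_pow, mul_pow]
    have : 0 ≤ p ^ a * (M : ℝ) ^ a := by positivity
    nlinarith
  have h4 : (0 : ℝ) < (M : ℝ) ^ a := by positivity
  refine le_of_mul_le_mul_left ?_ h4
  calc (M : ℝ) ^ a * (p ^ a / 2 * M.choose m) = p ^ a / 2 * M ^ a * M.choose m := by ring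
    _ ≤ ((m : ℝ) - b) ^ a * M.choose m := by gcongr
    _ ≤ _ := h1

end SubsetCounts

/-! ### Chernoff bound for uniformly random `m`-sets -/

section Concentration

/-- The mean `m = pM` is a mode of the binomial distribution, as ratios of consecutive terms show,
and the largest of `M + 1` terms with sum `1` is at least their average. -/
lemma one_le_succ_mul_binomial {M m : ℕ} {p : ℝ} (hp0 : 0 ≤ p) (hp1 : p ≤ 1) (hm : p * M = m)
    (hmM : m ≤ M) : 1 ≤ (M + 1) * (M.choose m * p ^ m * (1 - p) ^ (M - m)) := by
  set t : ℕ → ℝ := fun j => M.choose j * p ^ j * (1 - p) ^ (M - j) with ht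
  have hq : 0 ≤ 1 - p := by linarith
  have ht0 : ∀ j, 0 ≤ t j := fun j => by simp only [ht]; positivity
  have hrec : ∀ j < M, t (j + 1) * ((j + 1) * (1 - p)) = t j * ((M - j) * p) := by
    intro j hj
    have h1 : (M.choose (j + 1) : ℝ) * (j + 1) = M.choose j * (M - j) := by
      have := Nat.choose_succ_right_eq M j
      rw [← Nat.cast_sub hj.le]
      exact_mod_cast this
    have h2 : (1 - p) ^ (M - j) = (1 - p) ^ (M - (j + 1)) * (1 - p) := by
      rw [← pow_succ]; congr 1; omega
    simp only [ht, h2, pow_succ]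
    linear_combination (p ^ j * p * (1 - p) ^ (M - (j + 1)) * (1 - p)) * h1
  have hup : ∀ j < m, t j ≤ t (j + 1) := by
    intro j hj
    have hj' : (j : ℝ) + 1 ≤ m := by exact_mod_cast hj
    have hr := hrec j (by omega)
    have hjM : (j : ℝ) < M := by exact_mod_cast (show j < M by omega)
    have hpos : 0 < (M - j : ℝ) * p := by
      have : 0 < p := by
        rcases hp0.lt_or_eq with h | h
        · exact h
        · rw [← h] at hm; nlinarith [(Nat.cast_nonneg j : (0 : ℝ) ≤ j)]
      exact mul_pos (by linarith) this
    refine le_of_mul_le_mul_right ?_ hpos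
    rw [← hr]
    exact mul_le_mul_of_nonneg_left (by nlinarith) (ht0 _)
  have hdown : ∀ j, m ≤ j → j < M → t (j + 1) ≤ t j := by
    intro j hmj hj
    have hj' : (m : ℝ) ≤ j := by exact_mod_cast hmj
    have hr := hrec j hj
    have hjM : (j : ℝ) < M := by exact_mod_cast hj
    have hpos : 0 < ((j : ℝ) + 1) * (1 - p) := by
      have : p < 1 := by
        rcases hp1.lt_or_eq with h | h
        · exact h
        · rw [h] at hm; linarith
      exact mul_pos (by positivity) (by linarith)
    refine le_of_mul_le_mul_right ?_ hpos
    rw [hr]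
    exact mul_le_mul_of_nonneg_left (by nlinarith) (ht0 _)
  have hle : ∀ j ≤ M, t j ≤ t m := by
    intro j hj
    rcases le_total j m with h | h
    · induction h using Nat.decreasingInduction with
      | of_succ i hi ih => exact (hup i hi).trans (ih (by omega))
      | self => exact le_rfl
    · induction j, h using Nat.le_induction with
      | base => exact le_rfl
      | succ i hi ih => exact (hdown i hi (by omega)).trans (ih (by omega))
  have hsum : ∑ j ∈ Finset.range (M + 1), t j = 1 := by
    have := add_pow p (1 - p) M
    rw [add_sub_cancel, one_pow] at this
    rw [this]
    exact Finset.sum_congr rfl fun j _ => by simp only [ht]; ring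
  refine hsum.ge.trans ((Finset.sum_le_card_nsmul _ _ (t m) fun j hj => hle j ?_).trans (le_of_eq ?_))
  · have := Finset.mem_range.mp hj; omega
  · simp [ht]

variable {α : Type*} {s : Finset α}

/-- A uniform `m`-set is a set of independent `p`-choices conditioned on having size `m`. That event
has probability at least `1 / (M + 1)` with `M = s.card`, so conditioning costs at most a factor `M
+ 1`, and the independent expectation factorises. -/
lemma sum_powersetCard_prod_le {m : ℕ} {p : ℝ} (hp0 : 0 ≤ p) (hp1 : p ≤ 1)
    (hm : p * s.card = m) (hmM : m ≤ s.card) {x : α → ℝ} (hx : ∀ a, 0 ≤ x a) :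
    ∑ S ∈ s.powersetCard m, ∏ a ∈ S, x a ≤
      (s.card + 1) * s.card.choose m * Real.exp (p * ∑ a ∈ s, (x a - 1)) := by
  classical
  have hq : 0 ≤ 1 - p := by linarith
  set w : ℝ := p ^ m * (1 - p) ^ (s.card - m) with hw
  have hw0 : 0 ≤ w := by positivity
  have hmode : 1 ≤ (s.card + 1) * s.card.choose m * w := by
    have := one_le_succ_mul_binomial hp0 hp1 hm hmM
    rw [hw]; linarith
  have h1 : w * ∑ S ∈ s.powersetCard m, ∏ a ∈ S, x a ≤ Real.exp (p * ∑ a ∈ s, (x a - 1)) := by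
    calc w * ∑ S ∈ s.powersetCard m, ∏ a ∈ S, x a
        = ∑ S ∈ s.powersetCard m, (∏ a ∈ S, p * x a) * ∏ a ∈ s \ S, (1 - p) := by
          rw [Finset.mul_sum]
          refine Finset.sum_congr rfl fun S hS => ?_
          obtain ⟨hSs, hSm⟩ := Finset.mem_powersetCard.mp hS
          rw [Finset.prod_mul_distrib, Finset.prod_const, Finset.prod_const,
            Finset.card_sdiff_of_subset hSs, hSm, hw]
          ring
      _ ≤ ∑ S ∈ s.powerset, (∏ a ∈ S, p * x a) * ∏ a ∈ s \ S, (1 - p) := by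
          refine Finset.sum_le_sum_of_subset_of_nonneg (fun S hS =>
            Finset.mem_powerset.mpr (Finset.mem_powersetCard.mp hS).1)
            fun S _ _ => ?_
          exact mul_nonneg (Finset.prod_nonneg fun a _ => mul_nonneg hp0 (hx a))
            (Finset.prod_nonneg fun _ _ => hq)
      _ = ∏ a ∈ s, (p * x a + (1 - p)) := (Finset.prod_add _ _ _).symm
      _ ≤ ∏ a ∈ s, Real.exp (p * (x a - 1)) := by
          refine Finset.prod_le_prod (fun a _ => by have := mul_nonneg hp0 (hx a); linarith)
            fun a _ => ?_
          have := Real.add_one_le_exp (p * (x a - 1))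
          linarith
      _ = Real.exp (p * ∑ a ∈ s, (x a - 1)) := by rw [← Real.exp_sum, Finset.mul_sum]
  have h0 : 0 ≤ ∑ S ∈ s.powersetCard m, ∏ a ∈ S, x a :=
    Finset.sum_nonneg fun S _ => Finset.prod_nonneg fun a _ => hx a
  calc ∑ S ∈ s.powersetCard m, ∏ a ∈ S, x a
      ≤ ((s.card + 1) * s.card.choose m * w) * ∑ S ∈ s.powersetCard m, ∏ a ∈ S, x a :=
        le_mul_of_one_le_left h0 hmode
    _ = (s.card + 1) * s.card.choose m * (w * ∑ S ∈ s.powersetCard m, ∏ a ∈ S, x a) := by ring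
    _ ≤ _ := by gcongr

/-- The exponential-moment method; the sign `σ = ±1` handles both tails at once. -/
lemma card_filter_tail_le {m : ℕ} {p : ℝ} (hp0 : 0 ≤ p) (hp1 : p ≤ 1)
    (hm : p * s.card = m) (hmM : m ≤ s.card) {c : α → ℝ} {L ε σ : ℝ} (hL : 0 < L)
    (hc0 : ∀ a, 0 ≤ c a) (hcL : ∀ a ∈ s, c a ≤ L) (hε0 : 0 < ε) (hε1 : ε ≤ 1) (hσ : σ ^ 2 = 1) :
    (((s.powersetCard m).filter
      (fun S => ε * ∑ a ∈ s, c a ≤ σ * (∑ a ∈ S, c a - p * ∑ a ∈ s, c a))).card : ℝ) ≤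
      (s.card + 1) * s.card.choose m * Real.exp (-(ε ^ 2 * ∑ a ∈ s, c a) / (4 * L)) := by
  set T := ∑ a ∈ s, c a with hT
  have hT0 : 0 ≤ T := Finset.sum_nonneg fun a _ => hc0 a
  -- This minimises `-l ε T + l² L T`, with value `-ε² T / (4L)`, and keeps `l * c a ≤ 1` so that
  -- `exp x ≤ 1 + x + x²` applies.
  set l : ℝ := ε / (2 * L) with hl
  have hl0 : 0 < l := by positivity
  have hlL : l * L = ε / 2 := by rw [hl]; field_simp
  have hσabs : |σ| = 1 := by
    rw [← sq_eq_sq₀ (abs_nonneg _) zero_le_one, sq_abs, hσ, one_pow]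
  have hmgf := sum_powersetCard_prod_le hp0 hp1 hm hmM
    (x := fun a => Real.exp (σ * l * c a)) (fun a => (Real.exp_pos _).le)
  have hexp : ∑ a ∈ s, (Real.exp (σ * l * c a) - 1) ≤ σ * l * T + l ^ 2 * L * T := by
    rw [hT, Finset.mul_sum, Finset.mul_sum, ← Finset.sum_add_distrib]
    refine Finset.sum_le_sum fun a ha => ?_
    have hlc : l * c a ≤ ε / 2 := by
      rw [← hlL]; exact mul_le_mul_of_nonneg_left (hcL a ha) hl0.le
    have habs : |σ * l * c a| ≤ 1 := by
      rw [abs_mul, abs_mul, hσabs, one_mul, abs_of_pos hl0, abs_of_nonneg (hc0 a)]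
      linarith
    have h1 := (abs_le.mp (Real.abs_exp_sub_one_sub_id_le habs)).2
    have h2 : (σ * l * c a) ^ 2 = l ^ 2 * c a * c a := by
      rw [mul_pow, mul_pow, hσ]; ring
    have h3 : l ^ 2 * c a * c a ≤ l ^ 2 * L * c a := by
      have := mul_le_mul_of_nonneg_left (hcL a ha) (mul_nonneg (sq_nonneg l) (hc0 a))
      linarith
    linarith
  set F := (s.powersetCard m).filter (fun S => ε * T ≤ σ * (∑ a ∈ S, c a - p * T)) with hF
  have hmarkov : F.card * Real.exp (l * (ε * T + σ * p * T)) ≤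
      ∑ S ∈ s.powersetCard m, ∏ a ∈ S, Real.exp (σ * l * c a) := by
    rw [← nsmul_eq_mul]
    refine (Finset.card_nsmul_le_sum F (fun S => ∏ a ∈ S, Real.exp (σ * l * c a)) _ ?_).trans
      (Finset.sum_le_sum_of_subset_of_nonneg (Finset.filter_subset _ _)
        fun S _ _ => Finset.prod_nonneg fun a _ => (Real.exp_pos _).le)
    intro S hS
    have hS' := (Finset.mem_filter.mp hS).2
    rw [← Real.exp_sum, ← Finset.mul_sum, Real.exp_le_exp]
    have := mul_le_mul_of_nonneg_left hS' hl0.le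
    linarith
  have hfin : F.card * Real.exp (l * (ε * T + σ * p * T)) ≤
      (s.card + 1) * s.card.choose m * Real.exp (p * (σ * l * T + l ^ 2 * L * T)) := by
    refine hmarkov.trans (hmgf.trans ?_)
    gcongr
  have hexp2 : Real.exp (p * (σ * l * T + l ^ 2 * L * T)) ≤
      Real.exp (-(ε ^ 2 * T) / (4 * L)) * Real.exp (l * (ε * T + σ * p * T)) := by
    rw [← Real.exp_add, Real.exp_le_exp]
    have e1 : l ^ 2 * L * T = ε ^ 2 * T / (4 * L) := by rw [hl]; field_simp; ring
    have e2 : l * (ε * T) = 2 * (ε ^ 2 * T / (4 * L)) := by rw [hl]; field_simp; ring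
    have e3 : 0 ≤ ε ^ 2 * T / (4 * L) := by positivity
    have e4 : p * (ε ^ 2 * T / (4 * L)) ≤ ε ^ 2 * T / (4 * L) := mul_le_of_le_one_left e3 hp1
    rw [e1, mul_add l, e2, neg_div]
    linarith
  refine le_of_mul_le_mul_right (hfin.trans ?_) (Real.exp_pos (l * (ε * T + σ * p * T)))
  rw [mul_assoc ((s.card + 1 : ℝ) * s.card.choose m)]
  gcongr

end Concentration

/-! ### Averaging over choices of blocks -/

section Averages

variable {n k m : ℕ} {𝓑 : Finset (Finset (Fin n))}

lemma IsSteinerTriple.cycleEdges_subset_iff [NeZero n] (h : IsSteinerTriple k 𝓑) (hn : 3 ≤ n)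
    {S : Finset (Finset (Fin n))} {v : Equiv.Perm (Fin n)} :
    cycleEdges 3 v ⊆ (h.blockGraph S).edges ↔ h.cycleBlocks v ⊆ S := by
  rw [cycleBlocks, Finset.image_subset_iff]
  refine forall₂_congr fun e he => ?_
  obtain ⟨i, rfl⟩ := mem_cycleEdges.mp he
  simp [h.mem_edges_blockGraph, card_cycWindow hn]

lemma IsSteinerTriple.cycleBlocks_subset [NeZero n] (h : IsSteinerTriple k 𝓑) (hn : 3 ≤ n)
    (v : Equiv.Perm (Fin n)) : h.cycleBlocks v ⊆ 𝓑 := by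
  refine Finset.image_subset_iff.mpr fun e he => ?_
  obtain ⟨i, rfl⟩ := mem_cycleEdges.mp he
  exact (h.block_spec (card_cycWindow hn v i)).1

/-- Jensen's inequality, via the tangent line to `x ↦ a^x` at `k - 3`, a lower bound for the mean
number of overlaps. -/
lemma IsSteinerTriple.le_sum_pow_overlaps [NeZero n] (h : IsSteinerTriple k 𝓑) (hn : 4 ≤ n)
    {a : ℝ} (ha : 1 ≤ a) :
    (n.factorial : ℝ) * a ^ (k - 3) ≤ ∑ v : Equiv.Perm (Fin n), a ^ (h.overlaps v).card := by
  have ha0 : 0 < a := by linarith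
  have hl : 0 ≤ Real.log a := Real.log_nonneg ha
  have hexp : ∀ j : ℕ, a ^ j = Real.exp (j * Real.log a) := fun j => by
    rw [mul_comm, Real.exp_mul, Real.exp_log ha0, Real.rpow_natCast]
  have htan : ∀ v : Equiv.Perm (Fin n), a ^ (k - 3) *
      (1 + Real.log a * ((h.overlaps v).card - (k - 3 : ℕ))) ≤ a ^ (h.overlaps v).card := by
    intro v
    have h1 := Real.add_one_le_exp (Real.log a * ((h.overlaps v).card - (k - 3 : ℕ)))
    calc _ ≤ a ^ (k - 3) * Real.exp (Real.log a * ((h.overlaps v).card - (k - 3 : ℕ))) := by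
          gcongr; linarith
      _ = _ := by rw [hexp, hexp, ← Real.exp_add]; ring_nf
  refine le_trans ?_ (Finset.sum_le_sum fun v _ => htan v)
  have hs : (n.factorial : ℝ) * (k - 3 : ℕ) ≤
      ∑ v : Equiv.Perm (Fin n), ((h.overlaps v).card : ℝ) := by
    exact_mod_cast h.le_sum_card_overlaps hn
  rw [← Finset.mul_sum, Finset.sum_add_distrib, ← Finset.mul_sum, Finset.sum_sub_distrib]
  simp only [Finset.sum_const, Finset.card_univ, Fintype.card_perm, Fintype.card_fin,
    nsmul_eq_mul, mul_one]
  have h2 := mul_nonneg hl (sub_nonneg.mpr hs)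
  have h3 : 0 ≤ a ^ (k - 3) := by positivity
  nlinarith

/-- The total number of Hamiltonian cycles of the block graphs of all `m`-sets of blocks. -/
lemma IsSteinerTriple.le_sum_numHamCycles (h : IsSteinerTriple k 𝓑) (hn : 6 ≤ n) (hk : k < n)
    {p : ℝ} (hp0 : 0 < p) (hp1 : p ≤ 1) (hm : p * 𝓑.card = m) (hmM : m ≤ 𝓑.card)
    (hnm : 2 * n ^ 2 ≤ m) :
    (𝓑.card.choose m : ℝ) * (n.factorial * p ^ n) * ((1 / p) ^ (k - 3) / 2) ≤
      n ^ 3 * ∑ S ∈ 𝓑.powersetCard m, ((h.blockGraph S).numHamCycles : ℝ) := by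
  classical
  have : NeZero n := ⟨by omega⟩
  have hab : ∀ v, (h.cycleBlocks v).card + (h.overlaps v).card ≤ n :=
    h.card_cycleBlocks_add_card_overlaps_le (by omega) hk
  have hv : ∀ v : Equiv.Perm (Fin n),
      (𝓑.card.choose m : ℝ) * p ^ n / 2 * (1 / p) ^ (h.overlaps v).card ≤
        (((𝓑.powersetCard m).filter (fun S => h.cycleBlocks v ⊆ S)).card : ℝ) := by
    intro v
    rw [Finset.card_filter_powersetCard_subset _ _ _ (h.cycleBlocks_subset (by omega) v)
      (by have := hab v; nlinarith)]
    refine le_trans ?_ (half_pow_mul_choose_le hp0.le (b := n) (by have := hab v; omega) hnm hm hmM)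
    have h1 : p ^ n * (1 / p) ^ (h.overlaps v).card ≤ p ^ (h.cycleBlocks v).card := by
      have hX : (h.overlaps v).card ≤ n := by have := hab v; omega
      have : p ^ n * (1 / p) ^ (h.overlaps v).card = p ^ (n - (h.overlaps v).card) := by
        rw [one_div, inv_pow, ← div_eq_mul_inv, pow_sub₀ _ hp0.ne' hX, div_eq_mul_inv]
      rw [this]
      exact pow_le_pow_of_le_one hp0.le hp1 (by have := hab v; omega)
    have h2 : (0 : ℝ) ≤ 𝓑.card.choose m / 2 := by positivity
    have := mul_le_mul_of_nonneg_left h1 h2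
    linarith
  have hS : ∀ S, (((Finset.univ.filter (fun v : Equiv.Perm (Fin n) => h.cycleBlocks v ⊆ S)).card : ℕ) : ℝ)
      ≤ n ^ 3 * ((h.blockGraph S).numHamCycles : ℝ) := by
    intro S
    have := card_perms_le_numHamCycles hn (h.blockGraph S)
    simp only [h.cycleEdges_subset_iff (show 3 ≤ n by omega)] at this
    exact_mod_cast this
  have hswap : ∑ S ∈ 𝓑.powersetCard m,
        (Finset.univ.filter (fun v : Equiv.Perm (Fin n) => h.cycleBlocks v ⊆ S)).card =
      ∑ v : Equiv.Perm (Fin n), ((𝓑.powersetCard m).filter (fun S => h.cycleBlocks v ⊆ S)).card :=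
    (Finset.sum_card_bipartiteAbove_eq_sum_card_bipartiteBelow
      (fun (v : Equiv.Perm (Fin n)) S => h.cycleBlocks v ⊆ S)).symm
  have ha : 1 ≤ 1 / p := by rw [le_div_iff₀ hp0]; linarith
  have hc : (0 : ℝ) ≤ 𝓑.card.choose m * p ^ n / 2 := by positivity
  calc _ = (𝓑.card.choose m : ℝ) * p ^ n / 2 * (n.factorial * (1 / p) ^ (k - 3)) := by ring
    _ ≤ 𝓑.card.choose m * p ^ n / 2 *
        ∑ v : Equiv.Perm (Fin n), (1 / p) ^ (h.overlaps v).card :=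
      mul_le_mul_of_nonneg_left (h.le_sum_pow_overlaps (by omega) ha) hc
    _ ≤ ∑ v : Equiv.Perm (Fin n),
        (((𝓑.powersetCard m).filter (fun S => h.cycleBlocks v ⊆ S)).card : ℝ) := by
      rw [Finset.mul_sum]
      exact Finset.sum_le_sum fun v _ => hv v
    _ = ∑ S ∈ 𝓑.powersetCard m,
        (((Finset.univ.filter (fun v : Equiv.Perm (Fin n) => h.cycleBlocks v ⊆ S)).card : ℕ) : ℝ) := by
      exact_mod_cast hswap.symm
    _ ≤ _ := by
      rw [Finset.mul_sum]
      exact Finset.sum_le_sum fun S _ => hS S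

open Classical in
/-- Few `m`-sets of blocks have a block graph that is not quasi-random. -/
lemma IsSteinerTriple.card_not_isQuasiRandom_le (h : IsSteinerTriple k 𝓑) (hk : 3 ≤ k)
    (hkn : k ≤ n) (hn : 6 ≤ n) {p ε : ℝ} (hp0 : 0 ≤ p) (hp1 : p ≤ 1) (hε0 : 0 < ε) (hε1 : ε ≤ 1)
    (hm : p * 𝓑.card = m) (hmM : m ≤ 𝓑.card) :
    (((𝓑.powersetCard m).filter (fun S => ¬ (h.blockGraph S).IsQuasiRandom ε p)).card : ℝ) ≤
      2 ^ (n + 1) * ((𝓑.card + 1) * 𝓑.card.choose m *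
        Real.exp (-(ε ^ 2 * (n / 2).choose 3) / (4 * k.choose 3))) := by
  let c (W B : Finset (Fin n)) : ℝ := ((B ∩ W).card.choose 3 : ℕ)
  let F (W : Finset (Fin n)) (σ : ℝ) := (𝓑.powersetCard m).filter
    (fun S => ε * ∑ B ∈ 𝓑, c W B ≤ σ * (∑ B ∈ S, c W B - p * ∑ B ∈ 𝓑, c W B))
  have hT : ∀ W : Finset (Fin n), ∑ B ∈ 𝓑, c W B = W.card.choose 3 := by
    intro W
    rw [← h.sum_choose_inter W, Nat.cast_sum]
  have hF : ∀ W ∈ Finset.univ.powersetCard (n / 2), ∀ σ : ℝ, σ ^ 2 = 1 → ((F W σ).card : ℝ) ≤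
      (𝓑.card + 1) * 𝓑.card.choose m *
        Real.exp (-(ε ^ 2 * (n / 2).choose 3) / (4 * k.choose 3)) := by
    intro W hW σ hσ
    have hL : (0 : ℝ) < k.choose 3 := by exact_mod_cast Nat.choose_pos hk
    have := card_filter_tail_le (s := 𝓑) hp0 hp1 hm hmM (c := c W) hL (fun _ => Nat.cast_nonneg _)
      (fun B hB => ?_) hε0 hε1 hσ
    · rw [hT W, (Finset.mem_powersetCard.mp hW).2] at this
      simpa only [F, hT W, (Finset.mem_powersetCard.mp hW).2] using this
    · rw [← h.1 B hB]
      exact Nat.cast_le.mpr (Nat.choose_le_choose 3 (Finset.card_le_card Finset.inter_subset_left))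
  -- The global density is exact, so failure means an upper or lower deviation on some half-size
  -- `W`.
  have hsub : (𝓑.powersetCard m).filter (fun S => ¬ (h.blockGraph S).IsQuasiRandom ε p) ⊆
      (Finset.univ.powersetCard (n / 2)).biUnion (fun W => F W 1 ∪ F W (-1)) := by
    intro S hS
    obtain ⟨hSm, hSq⟩ := Finset.mem_filter.mp hS
    obtain ⟨hSB, hScard⟩ := Finset.mem_powersetCard.mp hSm
    have hdens : (h.blockGraph S).density = p :=
      h.density_blockGraph hk hkn hSB (by rw [hm, hScard])
    have : ∃ W : Finset (Fin n), W.card = n / 2 ∧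
        (h.blockGraph S).densityOn W ∉ Set.Ioo (p - ε) (p + ε) := by
      by_contra! hcon
      exact hSq ⟨hdens, hcon⟩
    obtain ⟨W, hW, hWd⟩ := this
    refine Finset.mem_biUnion.mpr ⟨W, Finset.mem_powersetCard.mpr ⟨Finset.subset_univ _, hW⟩, ?_⟩
    have hT0 : (0 : ℝ) < W.card.choose 3 := by
      exact_mod_cast Nat.choose_pos (by omega)
    have hd : (h.blockGraph S).densityOn W = (∑ B ∈ S, c W B) / W.card.choose 3 := by
      rw [RGraph.densityOn, h.card_edges_filter_subset hSB W, Nat.cast_sum]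
    rw [hd, Set.mem_Ioo, not_and_or, not_lt, not_lt, div_le_iff₀ hT0, le_div_iff₀ hT0] at hWd
    simp only [F, Finset.mem_union, Finset.mem_filter, hSm, true_and, hT]
    rcases hWd with hWd | hWd
    · right; linarith
    · left; linarith
  set b : ℝ := (𝓑.card + 1) * 𝓑.card.choose m *
    Real.exp (-(ε ^ 2 * (n / 2).choose 3) / (4 * k.choose 3)) with hb
  have hb0 : 0 ≤ b := by positivity
  have h1 : (((Finset.univ.powersetCard (n / 2)).biUnion (fun W => F W 1 ∪ F W (-1))).card : ℝ) ≤
      ∑ W ∈ (Finset.univ : Finset (Fin n)).powersetCard (n / 2), (2 * b) := by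
    refine le_trans (Nat.cast_le.mpr Finset.card_biUnion_le) ?_
    rw [Nat.cast_sum]
    refine Finset.sum_le_sum fun W hW => ?_
    have h2 : ((F W 1 ∪ F W (-1)).card : ℝ) ≤ (F W 1).card + (F W (-1)).card := by
      exact_mod_cast Finset.card_union_le _ _
    have := hF W hW 1 (by norm_num)
    have := hF W hW (-1) (by norm_num)
    linarith
  refine (Nat.cast_le.mpr (Finset.card_le_card hsub)).trans (h1.trans ?_)
  rw [Finset.sum_const, Finset.card_powersetCard, Finset.card_univ, Fintype.card_fin, nsmul_eq_mul]
  have h3 : (n.choose (n / 2) : ℝ) ≤ 2 ^ n := by exact_mod_cast Nat.choose_le_two_pow n (n / 2)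
  calc (n.choose (n / 2) : ℝ) * (2 * b) ≤ 2 ^ n * (2 * b) := by gcongr
    _ = 2 ^ (n + 1) * b := by ring

/-- If the maximum were smaller, quasi-random choices would contribute too little, while the few
others contribute at most `n!` each; the total would contradict the average. The hypothesis `hR`
compares these amounts after division by `p^n n!` and the number of choices. -/
lemma IsSteinerTriple.le_maxHamCycles (h : IsSteinerTriple k 𝓑) (hk : 3 ≤ k)
    (hkn : k < n) (hn : 6 ≤ n) {p ε R : ℝ} (hp0 : 0 < p) (hp1 : p ≤ 1) (hε0 : 0 < ε) (hε1 : ε ≤ 1)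
    (hm : p * 𝓑.card = m) (hmM : m ≤ 𝓑.card) (hnm : 2 * n ^ 2 ≤ m)
    (hR : n ^ 3 * (R + (1 / p) ^ n * (2 ^ (n + 1) * ((𝓑.card + 1) *
        Real.exp (-(ε ^ 2 * (n / 2).choose 3) / (4 * k.choose 3))))) < (1 / p) ^ (k - 3) / 2) :
    n.factorial * p ^ n * R ≤ maxHamCycles 3 n p ε := by
  classical
  by_contra! hcon
  set δ := Real.exp (-(ε ^ 2 * (n / 2).choose 3) / (4 * k.choose 3)) with hδ
  set Q := fun S => (h.blockGraph S).IsQuasiRandom ε p with hQ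
  have hC : (0 : ℝ) < 𝓑.card.choose m := by exact_mod_cast Nat.choose_pos hmM
  have hR0 : 0 ≤ n.factorial * p ^ n * R := (Nat.cast_nonneg _).trans hcon.le
  have hgood : ∑ S ∈ (𝓑.powersetCard m).filter Q, ((h.blockGraph S).numHamCycles : ℝ) ≤
      𝓑.card.choose m * (n.factorial * p ^ n * R) := by
    refine (Finset.sum_le_card_nsmul _ _ (n.factorial * p ^ n * R) fun S hS => ?_).trans ?_
    · exact (Nat.cast_le.mpr (numHamCycles_le_maxHamCycles (Finset.mem_filter.mp hS).2)).trans
        hcon.le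
    · rw [nsmul_eq_mul, ← Finset.card_powersetCard]
      exact mul_le_mul_of_nonneg_right (Nat.cast_le.mpr (Finset.card_filter_le _ _)) hR0
  have hbad : ∑ S ∈ (𝓑.powersetCard m).filter (fun S => ¬ Q S),
      ((h.blockGraph S).numHamCycles : ℝ) ≤
      (2 ^ (n + 1) * ((𝓑.card + 1) * 𝓑.card.choose m * δ)) * n.factorial := by
    refine (Finset.sum_le_card_nsmul _ _ (n.factorial : ℝ) fun S _ =>
      Nat.cast_le.mpr (numHamCycles_le_factorial _)).trans ?_
    rw [nsmul_eq_mul]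
    exact mul_le_mul_of_nonneg_right
      (h.card_not_isQuasiRandom_le hk hkn.le hn hp0.le hp1 hε0 hε1 hm hmM) (Nat.cast_nonneg _)
  have htot := h.le_sum_numHamCycles hn hkn hp0 hp1 hm hmM hnm
  rw [← Finset.sum_filter_add_sum_filter_not _ Q] at htot
  have hpp : p ^ n * (1 / p) ^ n = 1 := by
    rw [← mul_pow, mul_one_div_cancel hp0.ne', one_pow]
  have hpos : 0 < (𝓑.card.choose m : ℝ) * (n.factorial * p ^ n) := by positivity
  have h1 := mul_lt_mul_of_pos_left hR hpos
  have h2 : (𝓑.card.choose m : ℝ) * (n.factorial * p ^ n) * (n ^ 3 * (R + (1 / p) ^ n *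
      (2 ^ (n + 1) * ((𝓑.card + 1) * δ)))) = n ^ 3 * (𝓑.card.choose m * (n.factorial * p ^ n * R) +
      (2 ^ (n + 1) * ((𝓑.card + 1) * 𝓑.card.choose m * δ)) * n.factorial) := by
    linear_combination ((𝓑.card.choose m : ℝ) * n.factorial * n ^ 3 * 2 ^ (n + 1) *
      (𝓑.card + 1) * δ) * hpp
  have h3 : (n : ℝ) ^ 3 * (_ + _) ≤ n ^ 3 * (_ + _) :=
    mul_le_mul_of_nonneg_left (add_le_add hgood hbad) (by positivity)
  linarith

end Averages

lemma RGraph.IsQuasiRandom.mono {r n : ℕ} {G : RGraph r (Fin n)} {ε ε' p : ℝ}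
    (h : G.IsQuasiRandom ε p) (hε : ε ≤ ε') : G.IsQuasiRandom ε' p :=
  ⟨h.1, fun W hW => Set.Ioo_subset_Ioo (by linarith) (by linarith) (h.2 W hW)⟩

lemma maxHamCycles_mono {r n : ℕ} {ε ε' p : ℝ} (hε : ε ≤ ε') :
    maxHamCycles r n p ε ≤ maxHamCycles r n p ε' := by
  rcases Set.eq_empty_or_nonempty
    {h : ℕ | ∃ G : RGraph r (Fin n), G.IsQuasiRandom ε p ∧ G.numHamCycles = h} with h | h
  · rw [maxHamCycles, h, csSup_empty]
    exact Nat.zero_le _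
  · refine csSup_le h ?_
    rintro _ ⟨G, hG, rfl⟩
    exact numHamCycles_le_maxHamCycles (hG.mono hε)

/-! ### Numerical estimates in `q` -/

section Estimates

lemma pow_le_choose_three {q : ℕ} (hq : 2 ≤ q) :
    (q : ℝ) ^ 12 / 384 ≤ ((q ^ 4 + 1) / 2).choose 3 := by
  have h1 := Nat.descFactorial_eq_factorial_mul_choose ((q ^ 4 + 1) / 2) 3
  have hq4 : 16 ≤ q ^ 4 := by
    calc 16 = 2 ^ 4 := by norm_num
      _ ≤ q ^ 4 := Nat.pow_le_pow_left hq 4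
  obtain ⟨s, hs⟩ : ∃ s, (q ^ 4 + 1) / 2 = s + 2 := ⟨(q ^ 4 + 1) / 2 - 2, by omega⟩
  have hs4 : q ^ 4 ≤ 4 * s := by omega
  rw [hs] at h1 ⊢
  simp only [Nat.descFactorial_succ, Nat.descFactorial_zero, Nat.factorial] at h1
  simp only [Nat.add_sub_cancel, show s + 2 - 1 = s + 1 by omega, Nat.sub_zero, mul_one] at h1
  have h2 : s ^ 3 ≤ 6 * (s + 2).choose 3 := by
    norm_num at h1
    rw [← h1]
    nlinarith
  have h3 : (q ^ 4) ^ 3 ≤ (4 * s) ^ 3 := Nat.pow_le_pow_left hs4 3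
  have h4 : q ^ 12 ≤ 384 * (s + 2).choose 3 := by
    calc q ^ 12 = (q ^ 4) ^ 3 := by ring
      _ ≤ 64 * s ^ 3 := h3.trans (le_of_eq (by ring))
      _ ≤ 384 * (s + 2).choose 3 := by omega
  have h5 : (q : ℝ) ^ 12 ≤ 384 * (s + 2).choose 3 := by exact_mod_cast h4
  linarith

lemma succ_choose_three_le {q : ℕ} : (q + 1).choose 3 ≤ q ^ 3 := by
  have h1 := Nat.descFactorial_eq_factorial_mul_choose (q + 1) 3
  rcases q with _ | r
  · decide
  simp only [Nat.descFactorial_succ, Nat.descFactorial_zero, Nat.factorial,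
    show r + 1 + 1 - 2 = r by omega, show r + 1 + 1 - 1 = r + 1 by omega] at h1
  norm_num at h1
  nlinarith

/-- The error term from the block graphs that are not quasi-random is negligible. -/
lemma error_term_le_one {q n M : ℕ} {a ε : ℝ} (hq : 2 ≤ q) (hn : n = q ^ 4 + 1) (hM : M ≤ n ^ 3)
    (ha : 2 ≤ a) (hε : 0 < ε) (hqa : 21504 * Real.log a / ε ^ 2 ≤ q) :
    a ^ n * (2 ^ (n + 1) * ((M + 1) *
      Real.exp (-(ε ^ 2 * (n / 2).choose 3) / (4 * (q + 1).choose 3)))) ≤ 1 := by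
  have hq1 : (1 : ℝ) ≤ q := by exact_mod_cast (by omega : 1 ≤ q)
  have hq4 : 1 ≤ q ^ 4 := Nat.one_le_pow _ _ (by omega)
  have ha0 : 0 < a := by linarith
  have hlog : 0 ≤ Real.log a := Real.log_nonneg (by linarith)
  have hn1 : 1 ≤ n := by omega
  have hM1 : (M : ℝ) + 1 ≤ a ^ (3 * n + 1) := by
    have h1 : M + 1 ≤ 2 * n ^ 3 := by
      have : 1 ≤ n ^ 3 := Nat.one_le_pow _ _ hn1
      omega
    have h2 : (n : ℝ) ≤ a ^ n := by
      calc (n : ℝ) ≤ 2 ^ n := by exact_mod_cast Nat.lt_two_pow_self.le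
        _ ≤ a ^ n := by gcongr
    calc (M : ℝ) + 1 ≤ 2 * n ^ 3 := by exact_mod_cast h1
      _ ≤ a * (a ^ n) ^ 3 := by gcongr
      _ = a ^ (3 * n + 1) := by rw [← pow_mul]; ring
  have h2n : (2 : ℝ) ^ (n + 1) ≤ a ^ (n + 1) := by gcongr
  have hexp : Real.exp (-(ε ^ 2 * (n / 2).choose 3) / (4 * (q + 1).choose 3)) ≤
      Real.exp (-(14 * q ^ 4 * Real.log a)) := by
    rw [Real.exp_le_exp, neg_div, neg_le_neg_iff]
    have hL0 : (0 : ℝ) < (q + 1).choose 3 := by exact_mod_cast Nat.choose_pos (by omega)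
    have hL : ((q + 1).choose 3 : ℝ) ≤ q ^ 3 := by exact_mod_cast succ_choose_three_le
    have hT : (q : ℝ) ^ 12 / 384 ≤ (n / 2).choose 3 := by rw [hn]; exact pow_le_choose_three hq
    rw [le_div_iff₀ (by positivity)]
    rw [div_le_iff₀ (by positivity)] at hqa
    have hq5 : (q : ℝ) ≤ q ^ 5 := le_self_pow₀ hq1 (by norm_num)
    -- The threshold constant is `21504 = 14 * 4 * 384`.
    calc 14 * (q : ℝ) ^ 4 * Real.log a * (4 * (q + 1).choose 3)
        ≤ 14 * q ^ 4 * Real.log a * (4 * q ^ 3) := by gcongr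
      _ = 21504 * Real.log a * (q ^ 7 / 384) := by ring
      _ ≤ (q * ε ^ 2) * (q ^ 7 / 384) := by gcongr
      _ ≤ (q ^ 5 * ε ^ 2) * (q ^ 7 / 384) := by gcongr
      _ = ε ^ 2 * (q ^ 12 / 384) := by ring
      _ ≤ _ := by gcongr
  -- The exponent collects `n + (n + 1) + (3n + 1)` from the three factors, all written as powers of
  -- `a` using `a ≥ 2`.
  have hfin : a ^ (5 * n + 2) ≤ Real.exp (14 * q ^ 4 * Real.log a) := by
    calc a ^ (5 * n + 2) ≤ a ^ (14 * q ^ 4) := by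
          apply pow_le_pow_right₀ (by linarith); omega
      _ = Real.exp (14 * q ^ 4 * Real.log a) := by
          rw [mul_comm _ (Real.log a), Real.exp_mul, Real.exp_log ha0, ← Real.rpow_natCast]
          norm_cast
  calc _ ≤ a ^ n * (a ^ (n + 1) * (a ^ (3 * n + 1) * Real.exp (-(14 * q ^ 4 * Real.log a)))) := by
        gcongr
    _ = a ^ (5 * n + 2) * Real.exp (-(14 * q ^ 4 * Real.log a)) := by ring
    _ ≤ Real.exp (14 * q ^ 4 * Real.log a) * Real.exp (-(14 * q ^ 4 * Real.log a)) := by gcongr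
    _ = 1 := by rw [← Real.exp_add, add_neg_cancel, Real.exp_zero]

/-- Half of the exponential gain is given up: of `a^(q-2) = r^q r^q / a²`, one factor `r^q` absorbs
the polynomial losses and the other remains. -/
lemma main_term_lt {q n : ℕ} {a r : ℝ} (hq : 2 ≤ q) (hn : n = q ^ 4 + 1) (ha : 1 ≤ a) (hr : 1 ≤ r)
    (hra : r ^ 2 = a) (hqr : 32 * a ^ 2 * q ^ 12 < r ^ q) :
    (n : ℝ) ^ 3 * (r ^ q + 1) < a ^ (q + 1 - 3) / 2 := by
  have hn2 : (n : ℝ) ≤ 2 * q ^ 4 := by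
    have : 1 ≤ q ^ 4 := Nat.one_le_pow _ _ (by omega)
    exact_mod_cast (by omega : n ≤ 2 * q ^ 4)
  have hrq : 1 ≤ r ^ q := one_le_pow₀ hr
  have e : a ^ (q + 1 - 3) * a ^ 2 = r ^ q * r ^ q := by
    rw [← pow_add, show q + 1 - 3 + 2 = q by omega, ← hra, ← pow_mul, ← pow_add]
    congr 1; omega
  have ha2 : 0 < a ^ 2 := by positivity
  refine lt_of_mul_lt_mul_right ?_ ha2.le
  calc (n : ℝ) ^ 3 * (r ^ q + 1) * a ^ 2 ≤ (2 * q ^ 4) ^ 3 * (r ^ q + r ^ q) * a ^ 2 := by gcongr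
    _ = (32 * a ^ 2 * q ^ 12) * r ^ q / 2 := by ring
    _ < r ^ q * r ^ q / 2 := by gcongr
    _ = a ^ (q + 1 - 3) / 2 * a ^ 2 := by rw [← e]; ring

lemma rpow_quarter_le {q n : ℕ} {a : ℝ} (hq : 1 ≤ q) (hn : n = q ^ 4 + 1) (ha : 1 ≤ a) :
    a ^ ((1 : ℝ) / 4 * (n : ℝ) ^ ((1 : ℝ) / 4)) ≤ Real.sqrt a ^ q := by
  have h1 : (n : ℝ) ≤ (2 * q) ^ 4 := by
    have : 1 ≤ q ^ 4 := Nat.one_le_pow _ _ hq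
    have h : n ≤ (2 * q) ^ 4 := by rw [mul_pow]; omega
    exact_mod_cast h
  have h2 : (n : ℝ) ^ ((1 : ℝ) / 4) ≤ 2 * q := by
    calc (n : ℝ) ^ ((1 : ℝ) / 4) ≤ ((2 * q : ℝ) ^ 4) ^ ((1 : ℝ) / 4) := by gcongr
      _ = 2 * q := by
        rw [← Real.rpow_natCast, ← Real.rpow_mul (by positivity)]
        norm_num
  calc a ^ ((1 : ℝ) / 4 * (n : ℝ) ^ ((1 : ℝ) / 4)) ≤ a ^ ((1 : ℝ) / 2 * q) :=
        Real.rpow_le_rpow_of_exponent_le ha (by linarith)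
    _ = Real.sqrt a ^ q := by
        rw [Real.rpow_mul (by linarith), Real.rpow_natCast, Real.sqrt_eq_rpow]

end Estimates

end HyperHam

open HyperHam Filter in
theorem theorem3p1 :
    ∃ c : ℝ, 0 < c ∧
      ∀ p ε : ℝ, 0 < p → p < 1 → (∃ k : ℕ, 1 / p = (k : ℝ)) → 0 < ε →
        ∃ n₀ : ℕ, ∀ q n : ℕ, n₀ ≤ n → IsPrimePow q → n = q ^ 4 + 1 →
          (∃ m : ℕ, p * ((q : ℝ) ^ 3 * ((q : ℝ) ^ 6 + (q : ℝ) ^ 4 + (q : ℝ) ^ 2 + 1)) = (m : ℝ)) →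
            (1 / p) ^ (c * (n : ℝ) ^ ((1 : ℝ) / 4)) ≤
              (HyperHam.maxHamCycles 3 n p ε : ℝ) / HyperHam.expectedHamCycles n p := by
  refine ⟨1 / 4, by norm_num, fun p ε hp0 hp1 ⟨k, hk⟩ hε => ?_⟩
  set a := 1 / p with ha
  have ha1 : 1 < a := by rw [ha, lt_div_iff₀ hp0]; linarith
  -- Integrality of `1/p` bounds it away from `1`, so powers of `2` can be absorbed into powers of
  -- `a`.
  have ha2 : 2 ≤ a := by
    rw [hk] at ha1 ⊢
    have : 1 < k := by exact_mod_cast ha1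
    exact_mod_cast this
  have hr1 : 1 < Real.sqrt a := by rw [Real.lt_sqrt] <;> linarith
  have hra : Real.sqrt a ^ 2 = a := Real.sq_sqrt (by linarith)
  -- The tail bound needs `ε ≤ 1`; shrinking `ε` can only decrease the maximum.
  set ε' := min ε 1 with hε'
  have hε'0 : 0 < ε' := lt_min hε one_pos
  have hev : ∀ᶠ q : ℕ in atTop, 32 * a ^ 2 * (q : ℝ) ^ 12 < Real.sqrt a ^ q := by
    have hlim := tendsto_pow_const_div_const_pow_of_one_lt 12 hr1
    have hpos : (0 : ℝ) < 1 / (32 * a ^ 2) := by positivity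
    filter_upwards [hlim.eventually_lt_const hpos] with q hq
    rwa [div_lt_div_iff₀ (by positivity) (by positivity), one_mul, mul_comm] at hq
  obtain ⟨q₀, hq₀⟩ := eventually_atTop.mp (hev.and
    ((tendsto_natCast_atTop_atTop.eventually_ge_atTop (8 * a)).and
      (tendsto_natCast_atTop_atTop.eventually_ge_atTop (21504 * Real.log a / ε' ^ 2))))
  -- If `q < q₀` then `n = q ^ 4 + 1 ≤ q₀ ^ 4 + 1`, just below this threshold.
  refine ⟨q₀ ^ 4 + 2, fun q n hn₀ hq hn ⟨m, hm⟩ => ?_⟩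
  have hqq₀ : q₀ ≤ q := by
    by_contra! hlt
    have := Nat.pow_le_pow_left hlt.le 4
    omega
  obtain ⟨hqr, hq8, hqε⟩ := hq₀ q hqq₀
  have hq2 : 2 ≤ q := hq.two_le
  obtain ⟨𝓑, h⟩ := exists_isSteinerTriple hq
  have hM := h.card_eq hq2
  subst hn
  have hq4 : 16 ≤ q ^ 4 := Nat.pow_le_pow_left hq2 4
  have hqlt : q < q ^ 4 := lt_self_pow₀ (by omega) (by norm_num)
  have hm' : p * 𝓑.card = m := by rw [hM, ← hm]; push_cast; ring
  have hmM : m ≤ 𝓑.card := by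
    have : (m : ℝ) ≤ 𝓑.card := by
      rw [← hm']; exact mul_le_of_le_one_left (Nat.cast_nonneg _) hp1.le
    exact_mod_cast this
  -- Here `q ≥ 8a` enters: `m ≥ p q^9 ≥ 8 q^8 ≥ 2n²`.
  have hnm : 2 * (q ^ 4 + 1) ^ 2 ≤ m := by
    have h1 : (2 * ((q : ℝ) ^ 4 + 1) ^ 2) ≤ m := by
      have h16 : (1 : ℝ) ≤ (q : ℝ) ^ 4 := by exact_mod_cast (by omega : 1 ≤ q ^ 4)
      have h8 : 8 ≤ p * q := by
        have := mul_le_mul_of_nonneg_left hq8 hp0.le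
        rwa [ha, mul_left_comm, mul_one_div_cancel hp0.ne', mul_one] at this
      calc 2 * ((q : ℝ) ^ 4 + 1) ^ 2 ≤ 2 * ((q : ℝ) ^ 4 + q ^ 4) ^ 2 := by gcongr
        _ = 8 * (q : ℝ) ^ 8 := by ring
        _ ≤ p * q * q ^ 8 := by gcongr
        _ = p * (q ^ 3 * (q ^ 6 + 0 + 0 + 0)) := by ring
        _ ≤ m := by rw [← hm]; gcongr <;> positivity
    exact_mod_cast h1
  have hMn : 𝓑.card ≤ (q ^ 4 + 1) ^ 3 := by
    have h1 : 𝓑.card * 1 ≤ 𝓑.card * (q + 1).choose 3 :=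
      Nat.mul_le_mul_left _ (Nat.choose_pos (by omega))
    rw [h.card_mul_choose, mul_one] at h1
    exact h1.trans (Nat.choose_le_pow _ _)
  have herr := error_term_le_one hq2 rfl hMn ha2 hε'0 hqε
  have hmain := main_term_lt hq2 rfl ha1.le hr1.le hra hqr
  have hmax := h.le_maxHamCycles (R := Real.sqrt a ^ q) (by omega) (by omega) (by omega) hp0 hp1.le
    hε'0 (min_le_right _ _) hm' hmM hnm
    (lt_of_le_of_lt (mul_le_mul_of_nonneg_left (add_le_add_right herr _) (by positivity)) hmain)
  have hmono : (maxHamCycles 3 (q ^ 4 + 1) p ε' : ℝ) ≤ maxHamCycles 3 (q ^ 4 + 1) p ε :=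
    Nat.cast_le.mpr (maxHamCycles_mono (min_le_left _ _))
  refine (rpow_quarter_le (by omega) rfl ha1.le).trans ?_
  have hE : 0 < expectedHamCycles (q ^ 4 + 1) p := by
    unfold expectedHamCycles; positivity
  rw [le_div_iff₀ hE]
  refine le_trans ?_ (hmax.trans hmono)
  have hfac : (((q ^ 4 + 1 - 1).factorial : ℕ) : ℝ) ≤ (q ^ 4 + 1).factorial :=
    Nat.cast_le.mpr (Nat.factorial_le (Nat.sub_le _ _))
  have hEle : expectedHamCycles (q ^ 4 + 1) p ≤ (q ^ 4 + 1).factorial * p ^ (q ^ 4 + 1) := by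
    unfold expectedHamCycles
    have h1 := mul_le_mul_of_nonneg_left hfac (pow_nonneg hp0.le (q ^ 4 + 1))
    have h2 : 0 ≤ p ^ (q ^ 4 + 1) * (((q ^ 4 + 1 - 1).factorial : ℕ) : ℝ) := by positivity
    linarith
  rw [mul_comm]
  exact mul_le_mul_of_nonneg_right hEle (by positivity)
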